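/- Fix a finite set $N$ of atomic concepts. Concepts are generated by $C,D ::= q \mid A \mid C\ominus q \mid \neg C \mid C\wedge D \mid \Diamond C$ with $q\in\mathbb{Q}\cap[0,1]$ and $A\in N$; the rank of $C$ is the maximal nesting depth of $\Diamond$ and atomic concepts in $C$ (so constants have rank $0$, atomic concepts have rank $1$, $\Diamond$ raises the rank by $1$, and the propositional operators do not). A model $\mathcal I$ consists of a set $\Delta$ of states, functions $A^{\mathcal I}:\Delta\to[0,1]$ for $A\in N$, and functions $r_a:\Delta\to[0,1]$ for $a\in\Delta$, each of which satisfies $\sum_{a'}r_a(a')\in\{0,1\}$; the state $a$ is blocking if this sum is $0$. Concepts denote functions $C^{\mathcal I}:\Delta\to[0,1]$ via $q^{\mathcal I}(a)=q$, $(C\ominus q)^{\mathcal I}(a)=\max(C^{\mathcal I}(a)-q,0)$, $(\neg C)^{\mathcal I}(a)=1-C^{\mathcal I}(a)$, $(C\wedge D)^{\mathcal I}(a)=\min(C^{\mathcal I}(a),D^{\mathcal I}(a))$ and $(\Diamond C)^{\mathcal I}(a)=\sum_{a'}r_a(a')\,C^{\mathcal I}(a')$. For $d:\Delta\times\Delta\to[0,1]$,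 let $\mathrm{NE}(\Delta,d)$ be the set of all functions $f:\Delta\to[0,1]$ with $|f(a)-f(b)|\le d(a,b)$ for all $a,b$, equipped with the supremum metric. A coupling of two discrete probability distributions is a discrete probability distribution on the product with the given marginals. For discrete probability distributions $\pi_1,\pi_2$ on $\Delta$ put $$d^\uparrow(\pi_1,\pi_2)=\sup\{|\mathrm E_{\pi_1}(f)-\mathrm E_{\pi_2}(f)| : f\in \mathrm{NE}(\Delta,d)\},\qquad d^\downarrow(\pi_1,\pi_2)=\inf\{\mathrm E_\mu(d):\mu\text{ a coupling of }\pi_1,\pi_2\},$$ and extend both to the zero function, which has distance $1$ from every probability distribution and distance $0$ from itself. Define four distances of depth $n\ge 0$ on $\Delta$ (suprema over the empty set are $0$). * Wasserstein: $d^W_0=0$ and $d^W_{n+1}(a,b)=\max\bigl(\sup_{A\in N}|A^{\mathcal I}(a)-A^{\mathcal I}(b)|,\,(d^W_n)^\downarrow(r_a,r_b)\bigr)$. * Kantorovich: $d^K_0=0$ and $d^K_{n+1}(a,b)=\max\bigl(\sup_{A\in N}|A^{\mathcal I}(a)-A^{\mathcal I}(b)|,\,(d^K_n)^\uparrow(r_a,r_b)\bigr)$.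 * Logical: $d^L_n(a,b)=\sup\{|C^{\mathcal I}(a)-C^{\mathcal I}(b)| : C \text{ of rank at most } n\}$. * Game: $d^G_n(a,b)=\inf\{\epsilon\in[0,1] : \text{Duplicator wins the } n\text{-round game on }(a,b,\epsilon)\}$. The $0$-round game is an immediate win for Duplicator. In the $(n+1)$-round game on $(a,b,\epsilon)$, Duplicator loses unless $|A^{\mathcal I}(a)-A^{\mathcal I}(b)|\le\epsilon$ for all $A\in N$. If this condition holds, then she wins if $a,b$ are both blocking or $\epsilon=1$, and she loses if exactly one of $a,b$ is blocking and $\epsilon<1$. Otherwise, Duplicator picks a coupling $\mu$ of $r_a,r_b$ and a function $\epsilon':\Delta\times\Delta\to[0,1]$ with $\mathrm E_\mu(\epsilon')\le\epsilon$, then Spoiler picks a pair $(a',b')$ with $\mu(a',b')>0$, and play continues with the $n$-round game on $(a',b',\epsilon'(a',b'))$. **Theorem.** For every model $\mathcal I$ and every $n\ge 0$: 1. $d^G_n=d^W_n=d^K_n=d^L_n=:d_n$ on $\Delta$, and $d_n$ is a pseudometric with values in $[0,1]$; 2. $(\Delta,d_n)$ is totally bounded, i.e. for every $\epsilon>0$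 it is covered by finitely many balls $\{y : d_n(x,y)\le\epsilon\}$; 3. the functions $C^{\mathcal I}$ with $C$ of rank at most $n$ form a dense subset of $\mathrm{NE}(\Delta,d_n)$: each of them belongs to $\mathrm{NE}(\Delta,d_n)$, and for every $f\in\mathrm{NE}(\Delta,d_n)$ and every $\epsilon>0$ there is a concept $C$ of rank at most $n$ with $\sup_{a}|f(a)-C^{\mathcal I}(a)|<\epsilon$. -/

import Mathlib

namespace ProbALC

universe u v w

/-- Concepts of quantitative probabilistic `ALC` over the atomic concepts `NC`, with a single
role: truth constants, atoms, truncated subtraction of a constant, negation, conjunction and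
the modality "probably". -/
inductive Concept (NC : Type u) : Type u
  | const (q : Set.Icc (0 : ℚ) 1) : Concept NC
  | atom (A : NC) : Concept NC
  | sub (C : Concept NC) (q : Set.Icc (0 : ℚ) 1) : Concept NC
  | neg (C : Concept NC) : Concept NC
  | conj (C D : Concept NC) : Concept NC
  | dia (C : Concept NC) : Concept NC

/-- The rank of a concept: the maximal nesting depth of modalities and atomic concepts. -/
def Concept.rank {NC : Type u} : Concept NC → ℕ
  | .const _ => 0
  | .atom _ => 1
  | .sub C _ => C.rank
  | .neg C => C.rank
  | .conj C D => max C.rank D.rank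
  | .dia C => C.rank + 1

/-- A model with set of states `Δ`: fuzzy atomic concepts and, for each state `a`, a function
`r a` that is either zero or a (discrete) probability mass function. -/
structure Model (NC : Type u) (Δ : Type v) where
  atom : NC → Δ → ℝ
  atom_mem : ∀ A a, atom A a ∈ Set.Icc (0 : ℝ) 1
  r : Δ → Δ → ℝ
  r_mem : ∀ a a', r a a' ∈ Set.Icc (0 : ℝ) 1
  r_sum : ∀ a, HasSum (r a) 0 ∨ HasSum (r a) 1

/-- The expected value of `f` under the mass function `p`. -/
noncomputable def expectation {X : Type v} (p f : X → ℝ) : ℝ :=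
  ∑' x, p x * f x

/-- A state is blocking if its transition weights sum to zero. -/
def Model.Blocking {NC : Type u} {Δ : Type v} (I : Model NC Δ) (a : Δ) : Prop :=
  ∑' a', I.r a a' = 0

/-- The interpretation of concepts in a model. -/
noncomputable def Model.interp {NC : Type u} {Δ : Type v} (I : Model NC Δ) :
    Concept NC → Δ → ℝ
  | .const q, _ => ((q : ℚ) : ℝ)
  | .atom A, a => I.atom A a
  | .sub C q, a => max (I.interp C a - ((q : ℚ) : ℝ)) 0
  | .neg C, a => 1 - I.interp C a
  | .conj C D, a => min (I.interp C a) (I.interp D a)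
  | .dia C, a => expectation (I.r a) (fun a' => I.interp C a')

/-- The functions `X → [0,1]` denoted by concepts of rank at most `n`. -/
def Model.conceptFunctions {NC : Type u} {Δ : Type v} (I : Model NC Δ) (n : ℕ) :
    Set (Δ → ℝ) :=
  {g | ∃ C : Concept NC, C.rank ≤ n ∧ I.interp C = g}

/-- A pseudometric with values in `[0,1]`. -/
structure IsPseudometric {X : Type v} (d : X → X → ℝ) : Prop where
  mem : ∀ x y, d x y ∈ Set.Icc (0 : ℝ) 1
  refl : ∀ x, d x x = 0
  symm : ∀ x y, d x y = d y x
  triangle : ∀ x y z, d x z ≤ d x y + d y z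

/-- Total boundedness: finite covers by closed balls of every positive radius. -/
def IsTotallyBounded {X : Type v} (d : X → X → ℝ) : Prop :=
  ∀ ε : ℝ, 0 < ε → ∃ t : Finset X, ∀ y, ∃ x ∈ t, d x y ≤ ε

/-- The non-expansive functions `X → [0,1]` with respect to `d`. -/
def nonExp {X : Type v} (d : X → X → ℝ) : Set (X → ℝ) :=
  {f | (∀ x, f x ∈ Set.Icc (0 : ℝ) 1) ∧ ∀ x y, |f x - f y| ≤ d x y}

/-- The supremum distance (used for functions with values in `[0,1]`). -/
noncomputable def supDist {X : Type v} (f g : X → ℝ) : ℝ :=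
  ⨆ x, |f x - g x|

/-- `L` is a dense subset of `F` in the supremum distance. -/
def IsDenseSubset {X : Type v} (L F : Set (X → ℝ)) : Prop :=
  L ⊆ F ∧ ∀ f ∈ F, ∀ ε : ℝ, 0 < ε → ∃ g ∈ L, supDist f g < ε

/-- `μ` is a coupling of `p₁` and `p₂`: a discrete probability distribution on the product
with these marginals. -/
structure IsCoupling {X : Type v} {Y : Type w} (p₁ : X → ℝ) (p₂ : Y → ℝ)
    (μ : X × Y → ℝ) : Prop where
  nonneg : ∀ z, 0 ≤ μ z
  total : HasSum μ 1
  left : ∀ x, HasSum (fun y => μ (x, y)) (p₁ x)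
  right : ∀ y, HasSum (fun x => μ (x, y)) (p₂ y)

open Classical in
/-- Extension of a distance between distributions to zero functions: the zero function has
distance `1` from every other function, and distance `0` from itself. -/
noncomputable def extendZero {X : Type v} (D : (X → ℝ) → (X → ℝ) → ℝ) (p₁ p₂ : X → ℝ) : ℝ :=
  if p₁ = 0 ∧ p₂ = 0 then 0
  else if p₁ = 0 ∨ p₂ = 0 then 1
  else D p₁ p₂

/-- The Kantorovich lifting of `d`. -/
noncomputable def kantorovich {X : Type v} (d : X → X → ℝ) : (X → ℝ) → (X → ℝ) → ℝ :=
  extendZero fun p₁ p₂ =>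
    sSup {x | ∃ f ∈ nonExp d, x = |expectation p₁ f - expectation p₂ f|}

/-- The Wasserstein lifting of `d`. -/
noncomputable def wasserstein {X : Type v} (d : X → X → ℝ) : (X → ℝ) → (X → ℝ) → ℝ :=
  extendZero fun p₁ p₂ =>
    sInf {x | ∃ μ, IsCoupling p₁ p₂ μ ∧ x = expectation μ (fun z => d z.1 z.2)}

/-- The depth-`n` Wasserstein distance on a model. -/
noncomputable def Model.distW {NC : Type u} {Δ : Type v} (I : Model NC Δ) : ℕ → Δ → Δ → ℝ
  | 0, _, _ => 0
  | n + 1, a, b =>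
      max (⨆ A, |I.atom A a - I.atom A b|) (wasserstein (I.distW n) (I.r a) (I.r b))

/-- The depth-`n` Kantorovich distance on a model. -/
noncomputable def Model.distK {NC : Type u} {Δ : Type v} (I : Model NC Δ) : ℕ → Δ → Δ → ℝ
  | 0, _, _ => 0
  | n + 1, a, b =>
      max (⨆ A, |I.atom A a - I.atom A b|) (kantorovich (I.distK n) (I.r a) (I.r b))

/-- Duplicator wins the `n`-round bisimulation game from configuration `(a, b, ε)`. The game
with no rounds is won immediately. Otherwise the winning condition on atoms must hold; then
Duplicator wins at once if both states are blocking or `ε = 1`, loses if exactly one state is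
blocking (and `ε < 1`), and if no state is blocking, she needs a coupling `μ` and deviations
`ε'` of expected value at most `ε` such that she wins the remaining rounds from
`(a', b', ε' (a', b'))` whichever pair `(a', b')` of positive weight Spoiler picks. -/
def DuplicatorWins {NC : Type u} {Δ : Type v} {Δ' : Type w} (I : Model NC Δ)
    (J : Model NC Δ') : ℕ → Δ → Δ' → ℝ → Prop
  | 0, _, _, _ => True
  | n + 1, a, b, ε =>
      (∀ A, |I.atom A a - J.atom A b| ≤ ε) ∧
      ((I.Blocking a ∧ J.Blocking b) ∨ ε = 1 ∨
        (¬ I.Blocking a ∧ ¬ J.Blocking b ∧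
          ∃ (μ : Δ × Δ' → ℝ) (ε' : Δ × Δ' → ℝ),
            IsCoupling (I.r a) (J.r b) μ ∧
            (∀ z, ε' z ∈ Set.Icc (0 : ℝ) 1) ∧
            expectation μ ε' ≤ ε ∧
            ∀ a' b', 0 < μ (a', b') → DuplicatorWins I J n a' b' (ε' (a', b'))))

/-- The depth-`n` game distance. -/
noncomputable def distG {NC : Type u} {Δ : Type v} {Δ' : Type w} (I : Model NC Δ)
    (J : Model NC Δ') (n : ℕ) (a : Δ) (b : Δ') : ℝ :=
  sInf {ε | ε ∈ Set.Icc (0 : ℝ) 1 ∧ DuplicatorWins I J n a b ε}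

/-- The depth-`n` logical distance. -/
noncomputable def distL {NC : Type u} {Δ : Type v} {Δ' : Type w} (I : Model NC Δ)
    (J : Model NC Δ') (n : ℕ) (a : Δ) (b : Δ') : ℝ :=
  sSup {x | ∃ C : Concept NC, C.rank ≤ n ∧ x = |I.interp C a - J.interp C b|}

end ProbALC

namespace ProbALC

universe u v w

/-! All four distances are compared with the Kantorovich distance, by induction on the depth.

Wasserstein equals Kantorovich by discrete Kantorovich–Rubinstein duality with an optimal coupling.
The Riesz extension theorem gives a positive functional on bounded functions on the product with the
prescribed marginals. A priori it is only finitely additive, but as both marginals are carried by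
points up to small mass, no mass escapes and its values at singletons form a coupling. Reduction of
pairs of potentials to one non-expansive function is the usual infimal convolution
(`expectation_add_le_kantorovich`).

Kantorovich equals logical: concepts of rank `n + 1` are non-expansive because `◇` integrates a
function non-expansive for depth `n`. Conversely `◇C` realises the Kantorovich supremum up to any
error, once rank-`n` concepts are dense among non-expansive functions. Density is a lattice
Stone–Weierstrass argument (`isDenseSubset_conceptFunctions`): truncated arithmetic interpolates at
two points, minima and maxima extend this to a finite net. It needs total boundedness, which is
proved for the Kantorovich distances alone (`hasFiniteCodes_distK_succ`): non-expansive functions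
have a finite uniform net, so a state is determined up to `ε` by finitely many rounded numbers.

Game equals Kantorovich: Duplicator's deviations dominate the distance on the support of her
coupling; conversely she plays an optimal coupling with the distance plus a small slack. -/

/-! ### Discrete distributions, expectations and couplings. -/

/-- `p` is the mass function of a discrete probability distribution. -/
structure IsDist {X : Type v} (p : X → ℝ) : Prop where
  nonneg : ∀ x, 0 ≤ p x
  sum : HasSum p 1

/-- The space of bounded real functions. -/
def boundedFunctions (X : Type v) : Submodule ℝ (X → ℝ) where
  carrier := {f | ∃ c, ∀ x, |f x| ≤ c}
  zero_mem' := ⟨0, fun x => by simp⟩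
  add_mem' := by
    rintro f g ⟨c, hc⟩ ⟨c', hc'⟩
    exact ⟨c + c', fun x => (abs_add_le _ _).trans (add_le_add (hc x) (hc' x))⟩
  smul_mem' := by
    rintro a f ⟨c, hc⟩
    refine ⟨|a| * c, fun x => ?_⟩
    simpa [abs_mul] using mul_le_mul_of_nonneg_left (hc x) (abs_nonneg a)

theorem mem_boundedFunctions_of_mem_Icc {X : Type v} {f : X → ℝ} {a b : ℝ}
    (hf : ∀ x, f x ∈ Set.Icc a b) : f ∈ boundedFunctions X :=
  ⟨max |a| |b|, fun x => abs_le_max_abs_abs (hf x).1 (hf x).2⟩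

theorem const_mem_boundedFunctions {X : Type v} (c : ℝ) :
    (fun _ => c : X → ℝ) ∈ boundedFunctions X :=
  ⟨|c|, fun _ => le_rfl⟩

theorem comp_mem_boundedFunctions {X : Type v} {Y : Type w} {f : X → ℝ}
    (hf : f ∈ boundedFunctions X) (g : Y → X) : (fun y => f (g y)) ∈ boundedFunctions Y := by
  obtain ⟨c, hc⟩ := hf
  exact ⟨c, fun y => hc (g y)⟩

theorem indicator_mem_boundedFunctions {X : Type v} {f : X → ℝ}
    (hf : f ∈ boundedFunctions X) (s : Set X) : s.indicator f ∈ boundedFunctions X := by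
  obtain ⟨c, hc⟩ := hf
  refine ⟨c, fun x => ?_⟩
  by_cases hx : x ∈ s
  · simpa [hx] using hc x
  · simpa [hx] using (abs_nonneg _).trans (hc x)

theorem expectation_const_mul {X : Type v} (p f : X → ℝ) (a : ℝ) :
    expectation p (fun x => a * f x) = a * expectation p f := by
  simp only [expectation, ← tsum_mul_left]
  exact tsum_congr fun x => by ring

namespace IsDist

variable {X : Type v} {p : X → ℝ}

theorem summable_mul (hp : IsDist p) {f : X → ℝ} (hf : f ∈ boundedFunctions X) :
    Summable fun x => p x * f x := by
  obtain ⟨c, hc⟩ := hf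
  refine Summable.of_norm_bounded (hp.sum.summable.mul_right c) fun x => ?_
  rw [Real.norm_eq_abs, abs_mul, abs_of_nonneg (hp.nonneg x)]
  exact mul_le_mul_of_nonneg_left (hc x) (hp.nonneg x)

/-- Expectation as a linear functional on bounded functions. -/
noncomputable def expectationLinear (hp : IsDist p) : boundedFunctions X →ₗ[ℝ] ℝ where
  toFun f := expectation p f
  map_add' f g := by
    simp only [expectation, Submodule.coe_add, Pi.add_apply, mul_add]
    exact (hp.summable_mul f.2).tsum_add (hp.summable_mul g.2)
  map_smul' a f := expectation_const_mul p f a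

theorem expectation_const (hp : IsDist p) (c : ℝ) : expectation p (fun _ => c) = c := by
  simp [expectation, tsum_mul_right, hp.sum.tsum_eq]

theorem expectation_mono (hp : IsDist p) {f g : X → ℝ} (hf : f ∈ boundedFunctions X)
    (hg : g ∈ boundedFunctions X) (h : ∀ x, f x ≤ g x) : expectation p f ≤ expectation p g :=
  (hp.summable_mul hf).tsum_le_tsum
    (fun x => mul_le_mul_of_nonneg_left (h x) (hp.nonneg x)) (hp.summable_mul hg)

theorem expectation_add (hp : IsDist p) {f g : X → ℝ} (hf : f ∈ boundedFunctions X)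
    (hg : g ∈ boundedFunctions X) :
    expectation p (fun x => f x + g x) = expectation p f + expectation p g :=
  hp.expectationLinear.map_add ⟨f, hf⟩ ⟨g, hg⟩

theorem expectation_sub (hp : IsDist p) {f g : X → ℝ} (hf : f ∈ boundedFunctions X)
    (hg : g ∈ boundedFunctions X) :
    expectation p (fun x => f x - g x) = expectation p f - expectation p g :=
  hp.expectationLinear.map_sub ⟨f, hf⟩ ⟨g, hg⟩

theorem expectation_mem_Icc (hp : IsDist p) {f : X → ℝ} {a b : ℝ}
    (hf : ∀ x, f x ∈ Set.Icc a b) : expectation p f ∈ Set.Icc a b := by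
  have hb := mem_boundedFunctions_of_mem_Icc hf
  constructor
  · rw [← hp.expectation_const a]
    exact hp.expectation_mono (const_mem_boundedFunctions a) hb fun x => (hf x).1
  · rw [← hp.expectation_const b]
    exact hp.expectation_mono hb (const_mem_boundedFunctions b) fun x => (hf x).2

theorem abs_expectation_sub_le (hp : IsDist p) {f g e : X → ℝ} (hf : f ∈ boundedFunctions X)
    (hg : g ∈ boundedFunctions X) (he : e ∈ boundedFunctions X)
    (h : ∀ x, |f x - g x| ≤ e x) : |expectation p f - expectation p g| ≤ expectation p e := by
  rw [abs_le, neg_le, neg_sub, ← hp.expectation_sub hf hg, ← hp.expectation_sub hg hf]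
  exact ⟨hp.expectation_mono ((boundedFunctions X).sub_mem hg hf) he
      fun x => (abs_le'.1 (h x)).2.trans' (by simp),
    hp.expectation_mono ((boundedFunctions X).sub_mem hf hg) he fun x => (abs_le'.1 (h x)).1⟩

theorem abs_expectation_sub_le_const (hp : IsDist p) {f g : X → ℝ} {ε : ℝ}
    (hf : f ∈ boundedFunctions X) (hg : g ∈ boundedFunctions X)
    (h : ∀ x, |f x - g x| ≤ ε) : |expectation p f - expectation p g| ≤ ε :=
  (hp.abs_expectation_sub_le hf hg (const_mem_boundedFunctions ε) h).trans_eq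
    (hp.expectation_const ε)

theorem ne_zero (hp : IsDist p) : p ≠ 0 := by
  rintro rfl
  exact zero_ne_one (hasSum_zero.unique hp.sum)

theorem expectation_indicator_one (s : Finset X) :
    expectation p ((s : Set X).indicator fun _ => 1) = ∑ x ∈ s, p x := by
  classical
  rw [expectation, tsum_eq_sum (s := s)]
  · exact Finset.sum_congr rfl fun x hx => by simp [hx]
  · intro x hx
    simp [hx]

theorem prod (hp : IsDist p) {Y : Type w} {q : Y → ℝ} (hq : IsDist q) :
    IsCoupling p q fun z => p z.1 * q z.2 where
  nonneg z := mul_nonneg (hp.nonneg _) (hq.nonneg _)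
  total := by
    have := hp.sum.mul hq.sum
      (hp.sum.summable.mul_of_nonneg hq.sum.summable hp.nonneg hq.nonneg)
    simpa using this
  left x := by simpa using hq.sum.mul_left (p x)
  right y := by simpa using hp.sum.mul_right (q y)

end IsDist

namespace IsCoupling

variable {X : Type v} {Y : Type w} {p : X → ℝ} {q : Y → ℝ} {μ : X × Y → ℝ}

theorem isDist (h : IsCoupling p q μ) : IsDist μ := ⟨h.nonneg, h.total⟩

theorem expectation_fst (h : IsCoupling p q μ) {f : X → ℝ} (hf : f ∈ boundedFunctions X) :
    expectation μ (fun z => f z.1) = expectation p f := by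
  have hs := (h.isDist.summable_mul (comp_mem_boundedFunctions hf Prod.fst)).hasSum
  exact (hs.prod_fiberwise fun x => (h.left x).mul_right (f x)).tsum_eq.symm

theorem expectation_snd (h : IsCoupling p q μ) {f : Y → ℝ} (hf : f ∈ boundedFunctions Y) :
    expectation μ (fun z => f z.2) = expectation q f := by
  have hs := (h.isDist.summable_mul (comp_mem_boundedFunctions hf Prod.snd)).hasSum
  have hs' := (Equiv.prodComm Y X).hasSum_iff.2 hs
  exact (hs'.prod_fiberwise fun y => (h.right y).mul_right (f y)).tsum_eq.symm

end IsCoupling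

/-! ### Transport duality for bounded costs. -/

section Duality

variable {X : Type v} {Y : Type w} {p : X → ℝ} {q : Y → ℝ}

/-- Integrate `u x + v y` against the product coupling. -/
theorem expectation_add_nonneg (hp : IsDist p) (hq : IsDist q) {u : X → ℝ} {v : Y → ℝ}
    (hu : u ∈ boundedFunctions X) (hv : v ∈ boundedFunctions Y)
    (h : ∀ x y, 0 ≤ u x + v y) : 0 ≤ expectation p u + expectation q v := by
  have hc := hp.prod hq
  have hu' := comp_mem_boundedFunctions hu (Prod.fst : X × Y → X)
  have hv' := comp_mem_boundedFunctions hv (Prod.snd : X × Y → Y)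
  rw [← hc.expectation_fst hu, ← hc.expectation_snd hv, ← hc.isDist.expectation_add hu' hv',
    ← hc.isDist.expectation_const 0]
  exact hc.isDist.expectation_mono (const_mem_boundedFunctions 0)
    ((boundedFunctions _).add_mem hu' hv') fun z => h _ _

/-- A positive functional on bounded functions on the product with marginals `p` and `q` and
value at most `K` at `c`, provided that `K` bounds all values of the dual transport problem. -/
theorem exists_positive_functional (hp : IsDist p) (hq : IsDist q) {c : X × Y → ℝ}
    (hc : c ∈ boundedFunctions (X × Y)) {K : ℝ}
    (hK : ∀ u ∈ boundedFunctions X, ∀ v ∈ boundedFunctions Y,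
      (∀ x y, u x + v y ≤ c (x, y)) → expectation p u + expectation q v ≤ K) :
    ∃ l : boundedFunctions (X × Y) →ₗ[ℝ] ℝ,
      (∀ h, (∀ z, 0 ≤ h.1 z) → 0 ≤ l h) ∧
      (∀ h, ∀ u ∈ boundedFunctions X, ∀ v ∈ boundedFunctions Y,
        (∀ z, h.1 z = u z.1 + v z.2) → l h = expectation p u + expectation q v) ∧
      l ⟨c, hc⟩ ≤ K := by
  let E := boundedFunctions X × boundedFunctions Y × boundedFunctions (X × Y)
  -- Besides the nonnegative functions `u x + v y + h (x, y)`, the cone allows for multiples of `c -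
  -- K`. Positivity on it will yield both positivity of `l` and `l c ≤ K`.
  let s : PointedCone ℝ E :=
    { carrier := {w | ∃ t : ℝ, 0 ≤ t ∧
        ∀ x y, 0 ≤ w.1.1 x + w.2.1.1 y + w.2.2.1 (x, y) + t * (c (x, y) - K)}
      smul_mem' := by
        rintro ⟨a, ha⟩ w ⟨t, ht, h⟩
        refine ⟨a * t, mul_nonneg ha ht, fun x y => ?_⟩
        refine (mul_nonneg ha (h x y)).trans_eq ?_
        change _ = a * w.1.1 x + a * w.2.1.1 y + a * w.2.2.1 (x, y) + _
        ring
      zero_mem' := ⟨0, le_rfl, fun x y => by simp⟩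
      add_mem' := by
        rintro w w' ⟨t, ht, h⟩ ⟨t', ht', h'⟩
        refine ⟨t + t', add_nonneg ht ht', fun x y => ?_⟩
        refine (add_nonneg (h x y) (h' x y)).trans_eq ?_
        change _ = (w.1.1 x + w'.1.1 x) + (w.2.1.1 y + w'.2.1.1 y)
          + (w.2.2.1 (x, y) + w'.2.2.1 (x, y)) + _
        ring }
  let D : Submodule ℝ E := LinearMap.ker
    ((LinearMap.snd ℝ _ (boundedFunctions (X × Y))).comp
      (LinearMap.snd ℝ (boundedFunctions X) (boundedFunctions Y × boundedFunctions (X × Y))))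
  let F : E →ₗ[ℝ] ℝ := hp.expectationLinear.coprod
    (hq.expectationLinear.comp (LinearMap.fst ℝ _ (boundedFunctions (X × Y))))
  have hF : ∀ w : E, F w = expectation p w.1.1 + expectation q w.2.1.1 := fun w => rfl
  obtain ⟨g, hgF, hgs⟩ := riesz_extension s ⟨D, F.domRestrict D⟩
    (by
      rintro ⟨w, hw⟩ ⟨t, ht, h⟩
      have hw0 : w.2.2 = 0 := hw
      change 0 ≤ F w
      rw [hF]
      simp only [hw0, Submodule.coe_zero, Pi.zero_apply, add_zero] at h
      rcases ht.eq_or_lt with rfl | ht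
      · exact expectation_add_nonneg hp hq w.1.2 w.2.1.2 fun x y => by simpa using h x y
      -- Dividing by `t`, the pair `K - u / t`, `-v / t` is feasible for the dual problem, so its
      -- value `K - (E u + E v) / t` is at most `K`.
      · have h1 := hK (fun x => K + (-t⁻¹) * w.1.1 x)
          ((boundedFunctions X).add_mem (const_mem_boundedFunctions K)
            ((boundedFunctions X).smul_mem (-t⁻¹) w.1.2))
          (fun y => (-t⁻¹) * w.2.1.1 y) ((boundedFunctions Y).smul_mem (-t⁻¹) w.2.1.2)
          (fun x y => by
            have := mul_nonneg (inv_nonneg.2 ht.le) (h x y)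
            rw [mul_add, inv_mul_cancel_left₀ ht.ne'] at this
            linarith)
        have hu : (fun x => -t⁻¹ * w.1.1 x) ∈ boundedFunctions X :=
          (boundedFunctions X).smul_mem (-t⁻¹) w.1.2
        rw [hp.expectation_add (const_mem_boundedFunctions K) hu, hp.expectation_const,
          expectation_const_mul, expectation_const_mul] at h1
        have h2 : 0 ≤ t⁻¹ * (expectation p w.1.1 + expectation q w.2.1.1) := by linarith
        exact nonneg_of_mul_nonneg_right h2 (inv_pos.2 ht))
    (by
      rintro ⟨u, v, h⟩
      obtain ⟨b, hb⟩ := h.2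
      -- Every vector enters the cone after adding an element of `D`: cancel `u` and `v` and add a
      -- constant bounding `|h|`.
      refine ⟨⟨(⟨_, const_mem_boundedFunctions b⟩ - u, -v, 0), rfl⟩, 0, le_rfl,
        fun x y => ?_⟩
      have := neg_abs_le (h.1 (x, y))
      have := hb (x, y)
      change 0 ≤ (b - u.1 x + u.1 x) + (-v.1 y + v.1 y) + (0 + h.1 (x, y)) + 0 * (c (x, y) - K)
      linarith)
  have hg : ∀ w : E, w.2.2 = 0 → g w = expectation p w.1.1 + expectation q w.2.1.1 :=
    fun w hw => hgF ⟨w, hw⟩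
  have hsplit : ∀ w : E, g w = g (w.1, w.2.1, 0) + g (0, 0, w.2.2) := fun w => by
    rw [← map_add]
    exact congrArg g (Prod.ext (add_zero _).symm (Prod.ext (add_zero _).symm (zero_add _).symm))
  have hneg : ∀ h : boundedFunctions (X × Y), g (0, 0, -h) = - g (0, 0, h) := fun h => by
    rw [← map_neg]
    exact congrArg g (Prod.ext neg_zero.symm (Prod.ext neg_zero.symm rfl))
  have hmarg : ∀ h : boundedFunctions (X × Y), ∀ u ∈ boundedFunctions X,
      ∀ v ∈ boundedFunctions Y, (∀ z, h.1 z = u z.1 + v z.2) →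
      g (0, 0, h) = expectation p u + expectation q v := by
    intro h u hu v hv e
    -- If `h = u + v`, then `(-u, -v, h)` and its negative both lie in the cone, so `g` vanishes
    -- there.
    have h1 := hgs ((-⟨u, hu⟩, -⟨v, hv⟩, h) : E) ⟨0, le_rfl, fun x y => by
      change 0 ≤ -u x + -v y + h.1 (x, y) + 0 * (c (x, y) - K)
      rw [e]
      linarith⟩
    have h2 := hgs ((⟨u, hu⟩, ⟨v, hv⟩, -h) : E) ⟨0, le_rfl, fun x y => by
      change 0 ≤ u x + v y + -h.1 (x, y) + 0 * (c (x, y) - K)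
      rw [e]
      linarith⟩
    have h3 : g ((⟨u, hu⟩, ⟨v, hv⟩, -h) : E) = - g ((-⟨u, hu⟩, -⟨v, hv⟩, h) : E) := by
      rw [← map_neg]
      exact congrArg g (Prod.ext (neg_neg _).symm (Prod.ext (neg_neg _).symm rfl))
    have h4 : g ((⟨u, hu⟩, ⟨v, hv⟩, -h) : E) = 0 := by linarith
    rw [hsplit, hg _ rfl] at h4
    have h5 := hneg h
    dsimp only at h4
    linarith
  refine ⟨g.comp ((LinearMap.inr ℝ _ _).comp (LinearMap.inr ℝ _ _)), fun h hh => ?_,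
    hmarg, ?_⟩
  · exact hgs ((0, 0, h) : E) ⟨0, le_rfl, fun x y => by
      change 0 ≤ 0 + 0 + h.1 (x, y) + 0 * (c (x, y) - K)
      linarith [hh (x, y)]⟩
  -- `(K, 0, -c)` lies in the cone with `t = 1`, whence `K - l c ≥ 0`.
  · have h1 := hgs ((⟨_, const_mem_boundedFunctions K⟩, 0, -⟨c, hc⟩) : E)
      ⟨1, zero_le_one, fun x y => by
        change 0 ≤ K + 0 + -c (x, y) + 1 * (c (x, y) - K)
        linarith⟩
    rw [hsplit, hg _ rfl] at h1
    have h6 : expectation q (0 : Y → ℝ) = 0 := hq.expectation_const 0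
    simp only [hneg, Submodule.coe_zero, h6, hp.expectation_const] at h1
    change g ((0, 0, ⟨c, hc⟩) : E) ≤ K
    linarith

/-- Discrete transport duality for bounded cost functions: the primal problem attains every
upper bound of the dual problem. -/
theorem exists_coupling_expectation_le (hp : IsDist p) (hq : IsDist q) {c : X × Y → ℝ}
    (hc : c ∈ boundedFunctions (X × Y)) (hc0 : ∀ z, 0 ≤ c z) {K : ℝ}
    (hK : ∀ u ∈ boundedFunctions X, ∀ v ∈ boundedFunctions Y,
      (∀ x y, u x + v y ≤ c (x, y)) → expectation p u + expectation q v ≤ K) :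
    ∃ μ, IsCoupling p q μ ∧ expectation μ c ≤ K := by
  classical
  obtain ⟨l, hpos, hmarg, hcost⟩ := exists_positive_functional hp hq hc hK
  have hmono : ∀ h h' : boundedFunctions (X × Y), (∀ z, h.1 z ≤ h'.1 z) → l h ≤ l h' :=
    fun h h' hh => sub_nonneg.1 <| by
      rw [← map_sub]
      exact hpos _ fun z => sub_nonneg.2 (hh z)
  have hone : (fun _ => 1 : X × Y → ℝ) ∈ boundedFunctions (X × Y) := const_mem_boundedFunctions 1
  let ind (s : Set (X × Y)) : boundedFunctions (X × Y) :=
    ⟨_, indicator_mem_boundedFunctions hone s⟩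
  -- Only the point masses of `l` are kept; the bounds below show that nothing is lost.
  let μ : X × Y → ℝ := fun z => l (ind {z})
  have hμ0 : ∀ z, 0 ≤ μ z := fun z =>
    hpos _ fun z' => Set.indicator_nonneg (fun _ _ => zero_le_one) _
  have hsum : ∀ (s : Finset (X × Y)) (f : boundedFunctions (X × Y)),
      ∑ z ∈ s, μ z * f.1 z = l ⟨_, indicator_mem_boundedFunctions f.2 s⟩ := by
    intro s f
    have : (⟨_, indicator_mem_boundedFunctions f.2 s⟩ : boundedFunctions (X × Y))
        = ∑ z ∈ s, f.1 z • ind {z} := by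
      ext z'
      simp [ind, Set.indicator_apply, Pi.single_apply]
    rw [this, map_sum]
    exact Finset.sum_congr rfl fun z _ => by rw [map_smul, smul_eq_mul, mul_comm]
  have hsum1 : ∀ s : Finset (X × Y), ∑ z ∈ s, μ z = l (ind s) := by
    intro s
    simpa using hsum s ⟨_, hone⟩
  have hbX : ∀ s : Finset X, (s : Set X).indicator (fun _ => (1 : ℝ)) ∈ boundedFunctions X :=
    fun s => indicator_mem_boundedFunctions (const_mem_boundedFunctions 1) _
  have hbY : ∀ s : Finset Y, (s : Set Y).indicator (fun _ => (1 : ℝ)) ∈ boundedFunctions Y :=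
    fun s => indicator_mem_boundedFunctions (const_mem_boundedFunctions 1) _
  have hq0 : expectation q (fun _ => (0 : ℝ)) = 0 := hq.expectation_const 0
  have hp0 : expectation p (fun _ => (0 : ℝ)) = 0 := hp.expectation_const 0
  -- Tightness: the indicator of `s ×ˢ t` is at least the sum of those of `s` and `t` minus `1`.
  have hlower : ∀ (s : Finset X) (t : Finset Y),
      ∑ x ∈ s, p x + ∑ y ∈ t, q y - 1 ≤ ∑ z ∈ s ×ˢ t, μ z := by
    intro s t
    have hv := (boundedFunctions Y).sub_mem (hbY t) (const_mem_boundedFunctions 1)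
    have h1 := hmarg ⟨_, (boundedFunctions _).add_mem
      (comp_mem_boundedFunctions (hbX s) Prod.fst)
      (comp_mem_boundedFunctions hv Prod.snd)⟩ _ (hbX s) _ hv (fun z => rfl)
    have h2 : expectation q ((t : Set Y).indicator (fun _ => (1 : ℝ)) - fun _ => 1)
        = ∑ y ∈ t, q y - 1 := by
      rw [← IsDist.expectation_indicator_one (p := q)]
      refine Eq.trans ?_ (congrArg _ (hq.expectation_const 1))
      exact hq.expectation_sub (hbY t) (const_mem_boundedFunctions 1)
    rw [h2, IsDist.expectation_indicator_one, ← add_sub_assoc] at h1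
    rw [← h1, hsum1]
    refine hmono _ _ fun z => ?_
    by_cases hx : z.1 ∈ s <;> by_cases hy : z.2 ∈ t <;>
      simp [ind, Set.indicator_apply, hx, hy]
  have hleft_le : ∀ (x : X) (t : Finset Y), ∑ y ∈ t, μ (x, y) ≤ p x := by
    intro x t
    have h1 := hmarg ⟨_, comp_mem_boundedFunctions (hbX {x}) Prod.fst⟩ _ (hbX {x}) _
      (const_mem_boundedFunctions 0) (fun z => (add_zero _).symm)
    rw [hq0, IsDist.expectation_indicator_one, add_zero, Finset.sum_singleton] at h1
    have h2 : ∑ y ∈ t, μ (x, y) = ∑ z ∈ {x} ×ˢ t, μ z := by rw [Finset.sum_product]; simp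
    rw [h2, hsum1, ← h1]
    refine hmono _ _ fun z => ?_
    by_cases hx : z.1 = x <;> by_cases hy : z.2 ∈ t <;>
      simp [ind, -Finset.coe_product, -Finset.product_singleton, -Finset.singleton_product,
        hx, hy]
  have hright_le : ∀ (y : Y) (s : Finset X), ∑ x ∈ s, μ (x, y) ≤ q y := by
    intro y s
    have h1 := hmarg ⟨_, comp_mem_boundedFunctions (hbY {y}) Prod.snd⟩ _
      (const_mem_boundedFunctions 0) _ (hbY {y}) (fun z => (zero_add _).symm)
    rw [hp0, IsDist.expectation_indicator_one, zero_add, Finset.sum_singleton] at h1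
    have h2 : ∑ x ∈ s, μ (x, y) = ∑ z ∈ s ×ˢ {y}, μ z := by rw [Finset.sum_product]; simp
    rw [h2, hsum1, ← h1]
    refine hmono _ _ fun z => ?_
    by_cases hx : z.1 ∈ s <;> by_cases hy : z.2 = y <;>
      simp [ind, -Finset.coe_product, -Finset.product_singleton, -Finset.singleton_product,
        hx, hy]
  have hleft : ∀ x, HasSum (fun y => μ (x, y)) (p x) := by
    intro x
    have hs := summable_of_sum_le (fun y => hμ0 (x, y)) (hleft_le x)
    -- Exhaust `Y` by finite sets in `hlower {x} t`: the mass of `q` tends to `1`, so the row sum is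
    -- at least `p x`.
    have h1 : 1 ≤ ∑' y, μ (x, y) + 1 - p x :=
      hasSum_le_of_sum_le hq.sum fun t => by
        have := hlower {x} t
        rw [Finset.sum_product] at this
        simp only [Finset.sum_singleton] at this
        have := hs.sum_le_tsum t fun y _ => hμ0 (x, y)
        linarith
    have h2 := hs.tsum_le_of_sum_le (hleft_le x)
    rw [hs.hasSum_iff]
    linarith
  have hright : ∀ y, HasSum (fun x => μ (x, y)) (q y) := by
    intro y
    have hs := summable_of_sum_le (fun x => hμ0 (x, y)) (hright_le y)
    have h1 : 1 ≤ ∑' x, μ (x, y) + 1 - q y :=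
      hasSum_le_of_sum_le hp.sum fun s => by
        have := hlower s {y}
        rw [Finset.sum_product] at this
        simp only [Finset.sum_singleton] at this
        have := hs.sum_le_tsum s fun x _ => hμ0 (x, y)
        linarith
    have h2 := hs.tsum_le_of_sum_le (hright_le y)
    rw [hs.hasSum_iff]
    linarith
  have hs : Summable μ := by
    rw [summable_prod_of_nonneg hμ0]
    exact ⟨fun x => (hleft x).summable, by
      simpa only [(hleft _).tsum_eq] using hp.sum.summable⟩
  have htotal : HasSum μ 1 := by
    rw [hs.hasSum_iff, hs.tsum_prod]
    simp only [(hleft _).tsum_eq, hp.sum.tsum_eq]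
  refine ⟨μ, ⟨hμ0, htotal, hleft, hright⟩, le_trans ?_ hcost⟩
  have hd : IsDist μ := ⟨hμ0, htotal⟩
  -- Finite partial sums are values of `l` at truncations of `c`, which lie below `c` as `c ≥ 0`.
  refine (hd.summable_mul hc).tsum_le_of_sum_le fun s => ?_
  rw [hsum s ⟨c, hc⟩]
  exact hmono _ _ fun z => Set.indicator_le_self' (fun z _ => hc0 z) z

end Duality

/-! ### Kantorovich and Wasserstein liftings. -/

section Liftings

variable {X : Type v} {p q : X → ℝ} {d : X → X → ℝ}

theorem extendZero_zero_zero (D : (X → ℝ) → (X → ℝ) → ℝ) : extendZero D 0 0 = 0 := by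
  simp [extendZero]

theorem extendZero_zero_right (D : (X → ℝ) → (X → ℝ) → ℝ) (hp : p ≠ 0) :
    extendZero D p 0 = 1 := by
  simp [extendZero, hp]

theorem extendZero_zero_left (D : (X → ℝ) → (X → ℝ) → ℝ) (hq : q ≠ 0) :
    extendZero D 0 q = 1 := by
  simp [extendZero, hq]

theorem extendZero_of_ne (D : (X → ℝ) → (X → ℝ) → ℝ) (hp : p ≠ 0) (hq : q ≠ 0) :
    extendZero D p q = D p q := by
  simp [extendZero, hp, hq]

theorem mem_boundedFunctions_of_mem_nonExp {f : X → ℝ} (hf : f ∈ nonExp d) :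
    f ∈ boundedFunctions X :=
  mem_boundedFunctions_of_mem_Icc hf.1

theorem expectation_zero_left (f : X → ℝ) : expectation 0 f = 0 := by
  simp [expectation]

theorem abs_sub_le_one_of_mem_Icc {s t : ℝ} (hs : s ∈ Set.Icc (0 : ℝ) 1)
    (ht : t ∈ Set.Icc (0 : ℝ) 1) : |s - t| ≤ 1 :=
  (abs_sub_le_of_le_of_le hs.1 hs.2 ht.1 ht.2).trans_eq (sub_zero 1)

theorem expectation_mem_Icc_zero_one (hp : p = 0 ∨ IsDist p) {f : X → ℝ}
    (hf : ∀ x, f x ∈ Set.Icc (0 : ℝ) 1) : expectation p f ∈ Set.Icc (0 : ℝ) 1 := by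
  rcases hp with rfl | hp
  · simp [expectation_zero_left]
  · exact hp.expectation_mem_Icc hf

theorem le_kantorovich (hp : p = 0 ∨ IsDist p) (hq : q = 0 ∨ IsDist q) {f : X → ℝ}
    (hf : f ∈ nonExp d) : |expectation p f - expectation q f| ≤ kantorovich d p q := by
  have h1 : ∀ g ∈ nonExp d, |expectation p g - expectation q g| ≤ 1 := fun g hg =>
    abs_sub_le_one_of_mem_Icc (expectation_mem_Icc_zero_one hp hg.1)
      (expectation_mem_Icc_zero_one hq hg.1)
  by_cases hp0 : p = 0 <;> by_cases hq0 : q = 0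
  · simp [hp0, hq0, kantorovich, extendZero_zero_zero]
  · rw [kantorovich, hp0, extendZero_zero_left _ hq0, ← hp0]
    exact h1 f hf
  · rw [kantorovich, hq0, extendZero_zero_right _ hp0, ← hq0]
    exact h1 f hf
  · rw [kantorovich, extendZero_of_ne _ hp0 hq0]
    refine le_csSup ⟨1, ?_⟩ ⟨f, hf, rfl⟩
    rintro _ ⟨g, hg, rfl⟩
    exact h1 g hg

theorem kantorovich_le (hp : p ≠ 0) (hq : q ≠ 0) {c : ℝ} (hc : 0 ≤ c)
    (h : ∀ f ∈ nonExp d, |expectation p f - expectation q f| ≤ c) : kantorovich d p q ≤ c := by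
  rw [kantorovich, extendZero_of_ne _ hp hq]
  refine Real.sSup_le ?_ hc
  rintro _ ⟨f, hf, rfl⟩
  exact h f hf

theorem kantorovich_le_one (hp : p = 0 ∨ IsDist p) (hq : q = 0 ∨ IsDist q) :
    kantorovich d p q ≤ 1 := by
  by_cases hp0 : p = 0 <;> by_cases hq0 : q = 0
  · simp [hp0, hq0, kantorovich, extendZero_zero_zero]
  · rw [kantorovich, hp0, extendZero_zero_left _ hq0]
  · rw [kantorovich, hq0, extendZero_zero_right _ hp0]
  · exact kantorovich_le hp0 hq0 zero_le_one fun f hf =>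
      abs_sub_le_one_of_mem_Icc (expectation_mem_Icc_zero_one hp hf.1)
        (expectation_mem_Icc_zero_one hq hf.1)

theorem IsPseudometric.mem_boundedFunctions (hd : IsPseudometric d) :
    (fun z => d z.1 z.2) ∈ boundedFunctions (X × X) :=
  mem_boundedFunctions_of_mem_Icc fun z => hd.mem z.1 z.2

theorem kantorovich_le_expectation (hd : IsPseudometric d) (hp : IsDist p) (hq : IsDist q)
    {μ : X × X → ℝ} (hμ : IsCoupling p q μ) :
    kantorovich d p q ≤ expectation μ fun z => d z.1 z.2 := by
  refine kantorovich_le hp.ne_zero hq.ne_zero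
    (hμ.isDist.expectation_mem_Icc fun z => hd.mem z.1 z.2).1 fun f hf => ?_
  have hb := mem_boundedFunctions_of_mem_nonExp hf
  rw [← hμ.expectation_fst hb, ← hμ.expectation_snd hb]
  exact hμ.isDist.abs_expectation_sub_le (comp_mem_boundedFunctions hb _)
    (comp_mem_boundedFunctions hb _) hd.mem_boundedFunctions fun z => hf.2 z.1 z.2

/-- A pair of potentials below a pseudometric is dominated by a single non-expansive function. -/
theorem expectation_add_le_kantorovich (hd : IsPseudometric d) (hp : IsDist p) (hq : IsDist q)
    {u v : X → ℝ} (hu : u ∈ boundedFunctions X) (hv : v ∈ boundedFunctions X)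
    (h : ∀ x y, u x + v y ≤ d x y) :
    expectation p u + expectation q v ≤ kantorovich d p q := by
  have hne : Nonempty X := by
    by_contra hX
    rw [not_nonempty_iff] at hX
    exact hp.ne_zero (Subsingleton.elim _ _)
  obtain ⟨b, hb⟩ := hv
  have hbdd : ∀ x, BddBelow (Set.range fun y => d x y - v y) := fun x => ⟨-b, by
    rintro _ ⟨y, rfl⟩
    have := (hd.mem x y).1
    have := le_abs_self (v y)
    have := hb y
    dsimp only
    linarith⟩
  -- Infimal convolution: non-expansive by the triangle inequality, above `u` by `h`, and below `-v`
  -- by taking `y = x`.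
  let f : X → ℝ := fun x => ⨅ y, d x y - v y
  have hf_le : ∀ x y, f x ≤ d x y - v y := fun x y => ciInf_le (hbdd x) y
  have hfsub : ∀ x y, f x - f y ≤ d x y := fun x y => by
    rw [sub_le_iff_le_add', ← sub_le_iff_le_add]
    refine le_ciInf fun z => ?_
    have := hf_le x z
    have := hd.triangle x y z
    linarith
  have hfb : BddBelow (Set.range f) := ⟨-b, by
    rintro _ ⟨x, rfl⟩
    refine le_ciInf fun y => ?_
    have := (hd.mem x y).1
    have := le_abs_self (v y)
    have := hb y
    linarith⟩
  -- Since `d ≤ 1`, `f` oscillates by at most `1`, so a shift brings it into `[0,1]`. The shift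
  -- cancels in the difference of expectations.
  have hg : (fun x => f x - ⨅ y, f y) ∈ nonExp d := by
    refine ⟨fun x => ⟨sub_nonneg.2 (ciInf_le hfb x), ?_⟩, fun x y => ?_⟩
    · rw [sub_le_comm]
      refine le_ciInf fun y => ?_
      have := hfsub x y
      have := (hd.mem x y).2
      linarith
    · rw [sub_sub_sub_cancel_right, abs_sub_le_iff]
      exact ⟨hfsub x y, (hfsub y x).trans_eq (hd.symm y x)⟩
  have hfmem : f ∈ boundedFunctions X := by
    have := (boundedFunctions X).add_mem (mem_boundedFunctions_of_mem_nonExp hg)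
      (const_mem_boundedFunctions (⨅ y, f y))
    convert this using 1
    funext x
    simp
  have hc := const_mem_boundedFunctions (X := X) (⨅ y, f y)
  have h1 : expectation p u ≤ expectation p f := hp.expectation_mono hu hfmem fun x =>
    le_ciInf fun y => by linarith [h x y]
  have h2 : expectation q v ≤ - expectation q f := by
    rw [le_neg, ← neg_one_mul, ← expectation_const_mul]
    refine hq.expectation_mono hfmem ((boundedFunctions X).smul_mem (-1) ⟨b, hb⟩) fun x => ?_
    have := hf_le x x
    rw [hd.refl] at this
    linarith
  have h3 := (le_abs_self _).trans (le_kantorovich (.inr hp) (.inr hq) hg)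
  rw [hp.expectation_sub hfmem hc, hq.expectation_sub hfmem hc, hp.expectation_const,
    hq.expectation_const] at h3
  linarith

/-- **Kantorovich–Rubinstein duality** for discrete distributions, with an optimal coupling. -/
theorem exists_coupling_expectation_eq_kantorovich (hd : IsPseudometric d) (hp : IsDist p)
    (hq : IsDist q) :
    ∃ μ, IsCoupling p q μ ∧ expectation μ (fun z => d z.1 z.2) = kantorovich d p q := by
  obtain ⟨μ, hμ, h⟩ := exists_coupling_expectation_le hp hq hd.mem_boundedFunctions
    (fun z => (hd.mem _ _).1) fun u hu v hv => expectation_add_le_kantorovich hd hp hq hu hv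
  exact ⟨μ, hμ, h.antisymm (kantorovich_le_expectation hd hp hq hμ)⟩

theorem wasserstein_eq_kantorovich (hd : IsPseudometric d) (hp : p = 0 ∨ IsDist p)
    (hq : q = 0 ∨ IsDist q) : wasserstein d p q = kantorovich d p q := by
  rcases hp with rfl | hp <;> rcases hq with rfl | hq
  · simp [wasserstein, kantorovich, extendZero_zero_zero]
  · simp [wasserstein, kantorovich, extendZero_zero_left _ hq.ne_zero]
  · simp [wasserstein, kantorovich, extendZero_zero_right _ hp.ne_zero]
  · obtain ⟨μ, hμ, h⟩ := exists_coupling_expectation_eq_kantorovich hd hp hq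
    rw [wasserstein, extendZero_of_ne _ hp.ne_zero hq.ne_zero]
    refine IsLeast.csInf_eq ⟨⟨μ, hμ, h.symm⟩, ?_⟩
    rintro _ ⟨ν, hν, rfl⟩
    exact kantorovich_le_expectation hd hp hq hν

end Liftings

/-! ### Concept functions and the logical distance. -/

namespace Model

variable {NC : Type u} {Δ : Type v} (I : Model NC Δ)

theorem r_eq_zero_or_isDist (a : Δ) : I.r a = 0 ∨ IsDist (I.r a) :=
  (I.r_sum a).imp (hasSum_zero_iff_of_nonneg fun x => (I.r_mem a x).1).1
    fun h => ⟨fun x => (I.r_mem a x).1, h⟩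

theorem blocking_iff {a : Δ} : I.Blocking a ↔ I.r a = 0 := by
  refine ⟨fun h => (I.r_eq_zero_or_isDist a).resolve_right fun h1 => ?_, fun h => ?_⟩
  · rw [Blocking, h1.sum.tsum_eq] at h
    exact one_ne_zero h
  · simp [Blocking, h]

theorem isDist_of_not_blocking {a : Δ} (h : ¬ I.Blocking a) : IsDist (I.r a) :=
  (I.r_eq_zero_or_isDist a).resolve_left fun h0 => h (I.blocking_iff.2 h0)

theorem interp_mem_Icc (C : Concept NC) (a : Δ) : I.interp C a ∈ Set.Icc (0 : ℝ) 1 := by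
  induction C generalizing a with
  | const q =>
    simp only [interp]
    exact ⟨by exact_mod_cast q.2.1, by exact_mod_cast q.2.2⟩
  | atom A => exact I.atom_mem A a
  | sub C q ih =>
    have hq : (0 : ℝ) ≤ ((q : ℚ) : ℝ) := by exact_mod_cast q.2.1
    have := (ih a).2
    exact ⟨le_max_right _ _, max_le (by linarith) zero_le_one⟩
  | neg C ih => exact ⟨sub_nonneg.2 (ih a).2, sub_le_self _ (ih a).1⟩
  | conj C D ihC ihD => exact ⟨le_min (ihC a).1 (ihD a).1, (min_le_left _ _).trans (ihC a).2⟩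
  | dia C ih => exact expectation_mem_Icc_zero_one (I.r_eq_zero_or_isDist a) ih

theorem le_distL {n : ℕ} {C : Concept NC} (hC : C.rank ≤ n) (a b : Δ) :
    |I.interp C a - I.interp C b| ≤ distL I I n a b := by
  refine le_csSup ⟨1, ?_⟩ ⟨C, hC, rfl⟩
  rintro _ ⟨D, -, rfl⟩
  exact abs_sub_le_one_of_mem_Icc (I.interp_mem_Icc D a) (I.interp_mem_Icc D b)

theorem distL_le {n : ℕ} {a b : Δ} {c : ℝ}
    (h : ∀ C : Concept NC, C.rank ≤ n → |I.interp C a - I.interp C b| ≤ c) :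
    distL I I n a b ≤ c := by
  refine csSup_le ⟨_, Concept.const ⟨0, by simp⟩, Nat.zero_le n, rfl⟩ ?_
  rintro _ ⟨C, hC, rfl⟩
  exact h C hC

/-- Closure under negation reverses the sign of a difference, so the absolute value can be dropped.
-/
theorem exists_concept_lt {n : ℕ} {a b : Δ} {c : ℝ} (h : c < distL I I n a b) :
    ∃ C : Concept NC, C.rank ≤ n ∧ c < I.interp C a - I.interp C b := by
  by_contra! hc
  refine h.not_ge (I.distL_le fun C hC => abs_sub_le_iff.2 ⟨hc C hC, ?_⟩)
  have := hc C.neg hC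
  simp only [interp] at this
  linarith

theorem isPseudometric_distL (n : ℕ) : IsPseudometric (distL I I n) where
  mem a b :=
    ⟨(abs_nonneg _).trans (I.le_distL (C := .const ⟨0, by simp⟩) (Nat.zero_le n) a b),
      I.distL_le fun C _ => abs_sub_le_one_of_mem_Icc (I.interp_mem_Icc C a) (I.interp_mem_Icc C b)⟩
  refl a := le_antisymm (I.distL_le fun C _ => by simp)
    ((abs_nonneg _).trans (I.le_distL (C := .const ⟨0, by simp⟩) (Nat.zero_le n) a a))
  symm a b := by simp only [distL, abs_sub_comm (I.interp _ a)]
  triangle a b c := I.distL_le fun C hC => (abs_sub_le _ (I.interp C b) _).trans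
    (add_le_add (I.le_distL hC a b) (I.le_distL hC b c))

theorem conceptFunctions_subset_nonExp (n : ℕ) :
    I.conceptFunctions n ⊆ nonExp (distL I I n) := by
  rintro _ ⟨C, hC, rfl⟩
  exact ⟨I.interp_mem_Icc C, I.le_distL hC⟩

theorem const_mem_conceptFunctions {n : ℕ} {q : ℚ} (hq : q ∈ Set.Icc (0 : ℚ) 1) :
    (fun _ => (q : ℝ)) ∈ I.conceptFunctions n :=
  ⟨.const ⟨q, hq⟩, Nat.zero_le n, by funext a; simp [interp]⟩

theorem sub_mem_conceptFunctions {n : ℕ} {f : Δ → ℝ} (hf : f ∈ I.conceptFunctions n) {q : ℚ}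
    (hq : q ∈ Set.Icc (0 : ℚ) 1) : (fun a => max (f a - q) 0) ∈ I.conceptFunctions n := by
  obtain ⟨C, hC, rfl⟩ := hf
  exact ⟨.sub C ⟨q, hq⟩, hC, by funext a; simp [interp]⟩

theorem neg_mem_conceptFunctions {n : ℕ} {f : Δ → ℝ} (hf : f ∈ I.conceptFunctions n) :
    (fun a => 1 - f a) ∈ I.conceptFunctions n := by
  obtain ⟨C, hC, rfl⟩ := hf
  exact ⟨.neg C, hC, by funext a; simp [interp]⟩

theorem min_mem_conceptFunctions {n : ℕ} {f g : Δ → ℝ} (hf : f ∈ I.conceptFunctions n)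
    (hg : g ∈ I.conceptFunctions n) : (fun a => min (f a) (g a)) ∈ I.conceptFunctions n := by
  obtain ⟨C, hC, rfl⟩ := hf
  obtain ⟨D, hD, rfl⟩ := hg
  exact ⟨.conj C D, max_le hC hD, by funext a; simp [interp]⟩

theorem max_mem_conceptFunctions {n : ℕ} {f g : Δ → ℝ} (hf : f ∈ I.conceptFunctions n)
    (hg : g ∈ I.conceptFunctions n) : (fun a => max (f a) (g a)) ∈ I.conceptFunctions n := by
  convert I.neg_mem_conceptFunctions (I.min_mem_conceptFunctions
    (I.neg_mem_conceptFunctions hf) (I.neg_mem_conceptFunctions hg)) using 2 with a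
  rw [min_sub_sub_left, sub_sub_cancel]

end Model

/-! ### Density of concept functions. -/

theorem exists_rat_mem_Icc_near {s δ : ℝ} (hs : s ∈ Set.Icc (0 : ℝ) 1) (hδ : 0 < δ) :
    ∃ q : ℚ, q ∈ Set.Icc (0 : ℚ) 1 ∧ (q : ℝ) ≤ s ∧ s - δ ≤ q := by
  obtain ⟨q, h1, h2⟩ := exists_rat_btwn (sub_lt_self s hδ)
  refine ⟨max q 0, ⟨le_max_right _ _, max_le ?_ zero_le_one⟩, ?_, ?_⟩
  · exact_mod_cast h2.le.trans hs.2
  · rw [Rat.cast_max, Rat.cast_zero]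
    exact max_le h2.le hs.1
  · rw [Rat.cast_max]
    exact h1.le.trans (le_max_left _ _)

namespace Model

variable {NC : Type u} {Δ : Type v} (I : Model NC Δ)

/-- Concepts interpolate a non-expansive function approximately at any two points. -/
theorem exists_conceptFunction_interpolating_of_le {n : ℕ} {f : Δ → ℝ}
    (hf : f ∈ nonExp (distL I I n)) {a b : Δ} (hab : f b ≤ f a) {δ : ℝ} (hδ : 0 < δ) :
    ∃ g ∈ I.conceptFunctions n, |g a - f a| ≤ 2 * δ ∧ |g b - f b| ≤ 2 * δ := by
  obtain ⟨C, hC, hlt⟩ := I.exists_concept_lt (n := n) (a := a) (b := b) (c := f a - f b - δ)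
    (by linarith [hf.2 a b, le_abs_self (f a - f b)])
  have ha := hf.1 a
  have hb := hf.1 b
  -- With `q₁ ≈ C b`, `q₂ ≈ f a - f b` and `q₃ ≈ f b`, all rounded down, the witness is `min 1 (min
  -- (max (C - q₁) 0) q₂ + q₃)`. Truncated addition of `q₃` is subtraction conjugated by negation.
  obtain ⟨q₁, hq₁, h1, h1'⟩ := exists_rat_mem_Icc_near (I.interp_mem_Icc C b) hδ
  obtain ⟨q₂, hq₂, h2, h2'⟩ := exists_rat_mem_Icc_near (s := f a - f b)
    ⟨sub_nonneg.2 hab, by linarith [ha.2, hb.1]⟩ hδ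
  obtain ⟨q₃, hq₃, h3, h3'⟩ := exists_rat_mem_Icc_near hb hδ
  refine ⟨_, I.neg_mem_conceptFunctions (I.sub_mem_conceptFunctions
    (I.neg_mem_conceptFunctions (I.min_mem_conceptFunctions
      (I.sub_mem_conceptFunctions ⟨C, hC, rfl⟩ hq₁) (I.const_mem_conceptFunctions hq₂))) hq₃),
    ?_, ?_⟩
  · have hm : min (max (I.interp C a - q₁) 0) (q₂ : ℝ) ≤ f a - f b := (min_le_right _ _).trans h2
    have hm' : f a - f b - δ ≤ min (max (I.interp C a - q₁) 0) (q₂ : ℝ) :=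
      le_min (le_max_of_le_left (by linarith)) h2'
    rw [max_eq_left (by linarith [ha.2]), abs_le]
    constructor <;> linarith
  · have hm : min (max (I.interp C b - q₁) 0) (q₂ : ℝ) ≤ δ :=
      (min_le_left _ _).trans (max_le (by linarith) hδ.le)
    have hm' : 0 ≤ min (max (I.interp C b - q₁) 0) (q₂ : ℝ) :=
      le_min (le_max_right _ _) (by exact_mod_cast hq₂.1)
    have h4 := le_max_left (1 - min (max (I.interp C b - q₁) 0) (q₂ : ℝ) - q₃) 0
    have h5 : max (1 - min (max (I.interp C b - q₁) 0) (q₂ : ℝ) - q₃) 0 ≤ 1 - f b + δ :=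
      max_le (by linarith) (by linarith [hb.2])
    rw [abs_le]
    constructor <;> linarith

theorem exists_conceptFunction_interpolating {n : ℕ} {f : Δ → ℝ}
    (hf : f ∈ nonExp (distL I I n)) (a b : Δ) {δ : ℝ} (hδ : 0 < δ) :
    ∃ g ∈ I.conceptFunctions n, |g a - f a| ≤ δ ∧ |g b - f b| ≤ δ := by
  rcases le_total (f b) (f a) with h | h
  · simpa [mul_div_cancel₀] using
      I.exists_conceptFunction_interpolating_of_le hf h (half_pos hδ)
  · obtain ⟨g, hg, h1, h2⟩ := I.exists_conceptFunction_interpolating_of_le hf h (half_pos hδ)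
    rw [mul_div_cancel₀ _ two_ne_zero] at h1 h2
    exact ⟨g, hg, h2, h1⟩

/-- Take the minimum over `b ∈ t` of functions interpolating `f` at `a` and `b`. -/
theorem exists_conceptFunction_ge_le {n : ℕ} {f : Δ → ℝ} (hf : f ∈ nonExp (distL I I n))
    {δ : ℝ} (hδ : 0 < δ) (a : Δ) (t : Finset Δ) :
    ∃ g ∈ I.conceptFunctions n, f a - δ ≤ g a ∧ ∀ b ∈ t, g b ≤ f b + δ := by
  classical
  induction t using Finset.induction_on with
  | empty =>
    refine ⟨_, I.const_mem_conceptFunctions (q := 1) (by simp), ?_, by simp⟩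
    have := (hf.1 a).2
    push_cast
    linarith
  | insert b t _ ih =>
    obtain ⟨g, hg, h1, h2⟩ := ih
    obtain ⟨g', hg', h1', h2'⟩ := I.exists_conceptFunction_interpolating hf a b hδ
    refine ⟨_, I.min_mem_conceptFunctions hg hg',
      le_min h1 (by linarith [(abs_le.1 h1').1]), fun c hc => ?_⟩
    rcases Finset.mem_insert.1 hc with rfl | hc
    · exact (min_le_right _ _).trans (by linarith [(abs_le.1 h2').2])
    · exact (min_le_left _ _).trans (h2 c hc)

/-- Take the maximum over `a ∈ s` of the functions from `exists_conceptFunction_ge_le`. -/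
theorem exists_conceptFunction_near_on_finset {n : ℕ} {f : Δ → ℝ}
    (hf : f ∈ nonExp (distL I I n)) {δ : ℝ} (hδ : 0 < δ) (s t : Finset Δ) :
    ∃ g ∈ I.conceptFunctions n, (∀ a ∈ s, f a - δ ≤ g a) ∧ ∀ b ∈ t, g b ≤ f b + δ := by
  classical
  induction s using Finset.induction_on with
  | empty =>
    refine ⟨_, I.const_mem_conceptFunctions (q := 0) (by simp), by simp, fun b _ => ?_⟩
    have := (hf.1 b).1
    push_cast
    linarith
  | insert a s _ ih =>
    obtain ⟨g, hg, h1, h2⟩ := ih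
    obtain ⟨g', hg', h1', h2'⟩ := I.exists_conceptFunction_ge_le hf hδ a t
    refine ⟨_, I.max_mem_conceptFunctions hg hg', fun c hc => ?_,
      fun b hb => max_le (h2 b hb) (h2' b hb)⟩
    rcases Finset.mem_insert.1 hc with rfl | hc
    · exact h1'.trans (le_max_right _ _)
    · exact (h1 c hc).trans (le_max_left _ _)

/-- A Stone–Weierstraß type density result on totally bounded models. -/
theorem isDenseSubset_conceptFunctions {n : ℕ} (htb : IsTotallyBounded (distL I I n)) :
    IsDenseSubset (I.conceptFunctions n) (nonExp (distL I I n)) := by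
  refine ⟨I.conceptFunctions_subset_nonExp n, fun f hf ε hε => ?_⟩
  -- The error is `ε / 4` on the net, plus `ε / 4` each for moving `f` and `g` to the net; the total
  -- `3 * ε / 4` keeps the supremum strictly below `ε`.
  obtain ⟨t, ht⟩ := htb (ε / 4) (by positivity)
  obtain ⟨g, hg, h1, h2⟩ :=
    I.exists_conceptFunction_near_on_finset hf (δ := ε / 4) (by positivity) t t
  refine ⟨g, hg, (Real.iSup_le (a := 3 * ε / 4) (fun a => ?_) (by positivity)).trans_lt
    (by linarith)⟩
  obtain ⟨b, hb, hba⟩ := ht a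
  have hf' := abs_le.1 (hf.2 b a)
  have hg' := abs_le.1 ((I.conceptFunctions_subset_nonExp n hg).2 b a)
  have := h1 b hb
  have := h2 b hb
  rw [abs_le]
  constructor <;> linarith

end Model

/-! ### Finite codes and total boundedness. -/

section FiniteCodes

variable {X : Type v}

/-- For every `ε > 0`, the space splits into finitely many classes of diameter at most `ε`. -/
def HasFiniteCodes (d : X → X → ℝ) : Prop :=
  ∀ ε : ℝ, 0 < ε → ∃ (k : ℕ) (Φ : X → Fin k), ∀ x y, Φ x = Φ y → d x y ≤ ε

theorem exists_finite_code {κ : Type w} [Finite κ] {P : X → X → Prop} (Φ : X → κ)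
    (h : ∀ x y, Φ x = Φ y → P x y) : ∃ (k : ℕ) (Ψ : X → Fin k), ∀ x y, Ψ x = Ψ y → P x y := by
  obtain ⟨k, ⟨e⟩⟩ := Finite.exists_equiv_fin κ
  exact ⟨k, fun x => e (Φ x), fun x y hxy => h x y (e.injective hxy)⟩

theorem exists_finset_representatives {κ : Type w} [Finite κ] (Φ : X → κ) :
    ∃ t : Finset X, ∀ y, ∃ x ∈ t, Φ x = Φ y := by
  have hfin := Set.finite_range fun k : Set.range Φ => k.2.choose
  exact ⟨hfin.toFinset, fun y => ⟨(Set.mem_range_self (f := Φ) y).choose,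
    hfin.mem_toFinset.2 ⟨⟨Φ y, y, rfl⟩, rfl⟩, (Set.mem_range_self (f := Φ) y).choose_spec⟩⟩

theorem HasFiniteCodes.isTotallyBounded {d : X → X → ℝ} (h : HasFiniteCodes d) :
    IsTotallyBounded d := by
  intro ε hε
  obtain ⟨k, Φ, hΦ⟩ := h ε hε
  obtain ⟨t, ht⟩ := exists_finset_representatives Φ
  refine ⟨t, fun y => ?_⟩
  obtain ⟨x, hx, hxy⟩ := ht y
  exact ⟨x, hx, hΦ x y hxy⟩

theorem hasFiniteCodes_Icc {ε : ℝ} (hε : 0 < ε) :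
    ∃ (k : ℕ) (Φ : ℝ → Fin k), ∀ s ∈ Set.Icc (0 : ℝ) 1, ∀ t ∈ Set.Icc (0 : ℝ) 1,
      Φ s = Φ t → |s - t| ≤ ε := by
  -- The cap only makes the code total on `ℝ`; it has no effect on `[0,1]`.
  refine ⟨⌊1 / ε⌋₊ + 1, fun s => ⟨min ⌊s / ε⌋₊ ⌊1 / ε⌋₊, by omega⟩, fun s hs t ht h => ?_⟩
  have hle : ∀ r ∈ Set.Icc (0 : ℝ) 1, ⌊r / ε⌋₊ ≤ ⌊1 / ε⌋₊ := fun r hr =>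
    Nat.floor_le_floor (div_le_div_of_nonneg_right hr.2 hε.le)
  rw [Fin.mk.injEq, min_eq_left (hle s hs), min_eq_left (hle t ht)] at h
  have h1 := Nat.floor_le (div_nonneg hs.1 hε.le)
  have h2 := Nat.floor_le (div_nonneg ht.1 hε.le)
  have h3 := Nat.lt_floor_add_one (s / ε)
  have h4 := Nat.lt_floor_add_one (t / ε)
  rw [h] at h1 h3
  have h5 : |s / ε - t / ε| ≤ 1 := by
    rw [abs_le]
    constructor <;> linarith
  rwa [← sub_div, abs_div, abs_of_pos hε, div_le_one hε] at h5

/-- An Arzelà–Ascoli type statement: finitely many classes of non-expansive functions. -/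
theorem HasFiniteCodes.exists_nonExp_net {d : X → X → ℝ} (h : HasFiniteCodes d) {ε : ℝ}
    (hε : 0 < ε) :
    ∃ t : Finset (nonExp d), ∀ f ∈ nonExp d, ∃ g ∈ t, ∀ x, |f x - g.1 x| ≤ ε := by
  obtain ⟨k, Φ, hΦ⟩ := h (ε / 3) (by positivity)
  obtain ⟨s, hs⟩ := exists_finset_representatives Φ
  obtain ⟨m, q, hq⟩ := hasFiniteCodes_Icc (ε := ε / 3) (by positivity)
  -- A function is coded by its rounded values at representatives of the classes. Two with equal
  -- codes differ by `ε / 3` there, plus `ε / 3` each for moving within a class.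
  obtain ⟨t, ht⟩ := exists_finset_representatives fun (f : nonExp d) (x : s) => q (f.1 x)
  refine ⟨t, fun f hf => ?_⟩
  obtain ⟨g, hg, hgf⟩ := ht ⟨f, hf⟩
  refine ⟨g, hg, fun x => ?_⟩
  obtain ⟨y, hy, hyx⟩ := hs x
  have h1 := abs_le.1 (hq _ (g.2.1 y) _ (hf.1 y) (congrFun hgf ⟨y, hy⟩))
  have h2 := abs_le.1 ((hf.2 y x).trans (hΦ _ _ hyx))
  have h3 := abs_le.1 ((g.2.2 y x).trans (hΦ _ _ hyx))
  rw [abs_le]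
  constructor <;> linarith

end FiniteCodes

/-! ### Kantorovich, logical and Wasserstein distances agree. -/

namespace Model

variable {NC : Type u} {Δ : Type v} (I : Model NC Δ)

theorem abs_atom_sub_le_iSup [Finite NC] (A : NC) (a b : Δ) :
    |I.atom A a - I.atom A b| ≤ ⨆ A, |I.atom A a - I.atom A b| :=
  le_ciSup (f := fun A => |I.atom A a - I.atom A b|) (Set.finite_range _).bddAbove A

theorem iSup_abs_atom_sub_nonneg (a b : Δ) : 0 ≤ ⨆ A, |I.atom A a - I.atom A b| :=
  Real.iSup_nonneg fun _ => abs_nonneg _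

theorem distL_zero : distL I I 0 = fun _ _ => 0 := by
  have hconst : ∀ C : Concept NC, C.rank = 0 → ∀ a b, I.interp C a = I.interp C b := by
    intro C
    induction C with
    | const q => intro _ a b; simp [interp]
    | atom A => intro h; simp [Concept.rank] at h
    | sub C q ih => intro h a b; simp only [interp, ih h a b]
    | neg C ih => intro h a b; simp only [interp, ih h a b]
    | conj C D ihC ihD =>
      intro h a b
      simp only [Concept.rank, Nat.max_eq_zero_iff] at h
      simp only [interp, ihC h.1 a b, ihD h.2 a b]
    | dia C ih => intro h; simp [Concept.rank] at h
  funext a b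
  refine le_antisymm (I.distL_le fun C hC => ?_) ((I.isPseudometric_distL 0).mem a b).1
  simp [hconst C (Nat.le_zero.1 hC) a b]

theorem distK_zero : I.distK 0 = fun _ _ => 0 := by
  funext a b
  rw [distK]

theorem distW_zero : I.distW 0 = fun _ _ => 0 := by
  funext a b
  rw [distW]

theorem hasFiniteCodes_distK_zero : HasFiniteCodes (I.distK 0) := fun ε hε =>
  ⟨1, fun _ => 0, fun a b _ => by simpa [distK_zero] using hε.le⟩

/-- A state is coded by whether it blocks, its rounded atom values, and the rounded expectations of
a finite net of non-expansive functions. Replacing a test function by a net element costs `ε / 3` at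
each of the two states, rounding another `ε / 3`. -/
theorem hasFiniteCodes_distK_succ [Finite NC] {n : ℕ} (h : HasFiniteCodes (I.distK n)) :
    HasFiniteCodes (I.distK (n + 1)) := by
  intro ε hε
  obtain ⟨t, ht⟩ := h.exists_nonExp_net (ε := ε / 3) (by positivity)
  obtain ⟨m, q, hq⟩ := hasFiniteCodes_Icc (ε := ε / 3) (by positivity)
  refine exists_finite_code (fun a => ((I.Blocking a, fun A => q (I.atom A a),
    fun f : t => q (expectation (I.r a) f.1.1)) : Prop × (NC → Fin m) × (t → Fin m)))
    fun a b hab => ?_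
  simp only [Prod.mk.injEq] at hab
  obtain ⟨hbl, hat, hex⟩ := hab
  rw [distK]
  refine max_le (Real.iSup_le (fun A => (hq _ (I.atom_mem A a) _ (I.atom_mem A b)
    (congrFun hat A)).trans (by linarith)) hε.le) ?_
  rw [blocking_iff, blocking_iff, eq_iff_iff] at hbl
  have ha := I.r_eq_zero_or_isDist a
  have hb := I.r_eq_zero_or_isDist b
  by_cases h0 : I.r a = 0
  · rw [h0, hbl.1 h0, kantorovich, extendZero_zero_zero]
    exact hε.le
  have h0' : I.r b ≠ 0 := fun hb => h0 (hbl.2 hb)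
  refine kantorovich_le h0 h0' hε.le fun f hf => ?_
  obtain ⟨g, hg, hfg⟩ := ht f hf
  have hfb := mem_boundedFunctions_of_mem_nonExp hf
  have hgb := mem_boundedFunctions_of_mem_nonExp g.2
  have h1 := abs_le.1 ((ha.resolve_left h0).abs_expectation_sub_le_const hfb hgb hfg)
  have h2 := abs_le.1 ((hb.resolve_left h0').abs_expectation_sub_le_const hfb hgb hfg)
  have h3 := abs_le.1 (hq _ (expectation_mem_Icc_zero_one ha g.2.1) _
    (expectation_mem_Icc_zero_one hb g.2.1) (congrFun hex ⟨g, hg⟩))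
  rw [abs_le]
  constructor <;> linarith

theorem hasFiniteCodes_distK [Finite NC] (n : ℕ) : HasFiniteCodes (I.distK n) := by
  induction n with
  | zero => exact I.hasFiniteCodes_distK_zero
  | succ n ih => exact I.hasFiniteCodes_distK_succ ih

/-- Propositional operators do not increase differences; under `◇` stands a concept of rank at most
`n`, which is a Kantorovich test function at depth `n`. -/
theorem abs_interp_sub_le_distK_succ [Finite NC] {n : ℕ} (h : I.distK n = distL I I n)
    {C : Concept NC} (hC : C.rank ≤ n + 1) (a b : Δ) :
    |I.interp C a - I.interp C b| ≤ I.distK (n + 1) a b := by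
  have hnn : 0 ≤ I.distK (n + 1) a b := by
    rw [distK]
    exact (I.iSup_abs_atom_sub_nonneg a b).trans (le_max_left _ _)
  induction C with
  | const q => simpa [interp] using hnn
  | atom A =>
    rw [distK]
    simpa only [interp] using (I.abs_atom_sub_le_iSup A a b).trans (le_max_left _ _)
  | sub C q ih =>
    simp only [interp]
    refine (abs_max_sub_max_le_abs _ _ _).trans ?_
    rw [sub_sub_sub_cancel_right]
    exact ih hC
  | neg C ih =>
    simp only [interp]
    rw [sub_sub_sub_cancel_left, abs_sub_comm]
    exact ih hC
  | conj C D ihC ihD =>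
    simp only [interp]
    exact (abs_min_sub_min_le_max _ _ _ _).trans
      (max_le (ihC ((le_max_left _ _).trans hC)) (ihD ((le_max_right _ _).trans hC)))
  | dia C ih =>
    rw [distK]
    simp only [interp]
    refine (le_kantorovich (I.r_eq_zero_or_isDist a) (I.r_eq_zero_or_isDist b) ?_).trans
      (le_max_right _ _)
    rw [h]
    exact I.conceptFunctions_subset_nonExp n ⟨C, Nat.succ_le_succ_iff.1 hC, rfl⟩

theorem kantorovich_le_distL_succ {n : ℕ}
    (hdense : IsDenseSubset (I.conceptFunctions n) (nonExp (distL I I n))) (a b : Δ) :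
    kantorovich (distL I I n) (I.r a) (I.r b) ≤ distL I I (n + 1) a b := by
  have hL := (I.isPseudometric_distL (n + 1)).mem a b
  have ha := I.r_eq_zero_or_isDist a
  have hb := I.r_eq_zero_or_isDist b
  -- The concept `◇1` is `0` at blocking states and `1` elsewhere, so it realises the distance `1`
  -- between the two kinds.
  have htop := I.le_distL (n := n + 1) (C := .dia (.const ⟨1, by simp⟩))
    (by simp [Concept.rank]) a b
  simp only [interp, Rat.cast_one] at htop
  by_cases ha0 : I.r a = 0 <;> by_cases hb0 : I.r b = 0
  · rw [ha0, hb0, kantorovich, extendZero_zero_zero]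
    exact hL.1
  · rw [ha0, expectation_zero_left, (hb.resolve_left hb0).expectation_const] at htop
    rw [ha0, kantorovich, extendZero_zero_left _ hb0]
    simpa using htop
  · rw [hb0, expectation_zero_left, (ha.resolve_left ha0).expectation_const] at htop
    rw [hb0, kantorovich, extendZero_zero_right _ ha0]
    simpa using htop
  · refine kantorovich_le ha0 hb0 hL.1 fun f hf => le_of_forall_pos_le_add fun ε hε => ?_
    obtain ⟨g, hg, hfg⟩ := hdense.2 f hf (ε / 2) (by positivity)
    have hg' := hdense.1 hg
    have hnear : ∀ x, |f x - g x| ≤ ε / 2 := fun x => le_trans (le_ciSup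
      (f := fun x => |f x - g x|) ⟨1, by
        rintro _ ⟨y, rfl⟩
        exact abs_sub_le_one_of_mem_Icc (hf.1 y) (hg'.1 y)⟩ x) hfg.le
    have hfb := mem_boundedFunctions_of_mem_nonExp hf
    have hgb := mem_boundedFunctions_of_mem_nonExp hg'
    have h1 := abs_le.1 ((ha.resolve_left ha0).abs_expectation_sub_le_const hfb hgb hnear)
    have h2 := abs_le.1 ((hb.resolve_left hb0).abs_expectation_sub_le_const hfb hgb hnear)
    obtain ⟨C, hC, rfl⟩ := hg
    have h3 := I.le_distL (n := n + 1) (C := .dia C) (Nat.succ_le_succ hC) a b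
    simp only [interp] at h3
    rw [abs_le] at h3 ⊢
    constructor <;> linarith

theorem distK_succ_eq_distL [Finite NC] {n : ℕ} (h : I.distK n = distL I I n)
    (hdense : IsDenseSubset (I.conceptFunctions n) (nonExp (distL I I n))) :
    I.distK (n + 1) = distL I I (n + 1) := by
  funext a b
  refine le_antisymm ?_ (I.distL_le fun C hC => I.abs_interp_sub_le_distK_succ h hC a b)
  rw [distK, h]
  refine max_le (Real.iSup_le (fun A => ?_) ((I.isPseudometric_distL (n + 1)).mem a b).1)
    (I.kantorovich_le_distL_succ hdense a b)
  simpa only [interp] using I.le_distL (n := n + 1) (C := .atom A) (by simp [Concept.rank]) a b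

/-- Total boundedness is known on the Kantorovich side; the induction hypothesis carries it to the
logical side, where density at rank `n` needs it. -/
theorem distK_eq_distL [Finite NC] (n : ℕ) : I.distK n = distL I I n := by
  induction n with
  | zero => rw [distK_zero, distL_zero]
  | succ n ih =>
    refine I.distK_succ_eq_distL ih (I.isDenseSubset_conceptFunctions ?_)
    rw [← ih]
    exact (I.hasFiniteCodes_distK n).isTotallyBounded

theorem isPseudometric_distK [Finite NC] (n : ℕ) : IsPseudometric (I.distK n) := by
  rw [distK_eq_distL]
  exact I.isPseudometric_distL n

theorem distW_eq_distK [Finite NC] (n : ℕ) : I.distW n = I.distK n := by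
  induction n with
  | zero => rw [distW_zero, distK_zero]
  | succ n ih =>
    funext a b
    rw [distW, distK, ih, wasserstein_eq_kantorovich (I.isPseudometric_distK n)
      (I.r_eq_zero_or_isDist a) (I.r_eq_zero_or_isDist b)]

end Model

/-! ### The game distance. -/

section Game

variable {NC : Type u} {Δ : Type v} (I : Model NC Δ)

theorem DuplicatorWins.mono {Δ' : Type w} {J : Model NC Δ'} {n : ℕ} {a : Δ} {b : Δ'} {ε ε' : ℝ}
    (h : DuplicatorWins I J n a b ε) (hε : ε ≤ ε') (hε' : ε' ≤ 1) :
    DuplicatorWins I J n a b ε' := by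
  cases n with
  | zero => trivial
  | succ n =>
    obtain ⟨hA, h⟩ := h
    refine ⟨fun A => (hA A).trans hε, ?_⟩
    rcases h with h | rfl | ⟨ha, hb, μ, e, hμ, he, hexp, hwin⟩
    · exact .inl h
    -- Duplicator's outright win at deviation `1` survives because `ε' ≤ 1` forces `ε' = 1`.
    · exact .inr (.inl (hε'.antisymm hε))
    · exact .inr (.inr ⟨ha, hb, μ, e, hμ, he, hexp.trans hε, hwin⟩)

theorem duplicatorWins_one {Δ' : Type w} (J : Model NC Δ') (n : ℕ) (a : Δ) (b : Δ') :
    DuplicatorWins I J n a b 1 := by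
  cases n with
  | zero => trivial
  | succ n =>
    exact ⟨fun A => abs_sub_le_one_of_mem_Icc (I.atom_mem A a) (J.atom_mem A b), .inr (.inl rfl)⟩

theorem distG_le {n : ℕ} {a b : Δ} {ε : ℝ} (hε : ε ∈ Set.Icc (0 : ℝ) 1)
    (h : DuplicatorWins I I n a b ε) : distG I I n a b ≤ ε :=
  csInf_le ⟨0, fun _ h => h.1.1⟩ ⟨hε, h⟩

theorem le_distG {n : ℕ} {a b : Δ} {c : ℝ}
    (h : ∀ ε ∈ Set.Icc (0 : ℝ) 1, DuplicatorWins I I n a b ε → c ≤ ε) : c ≤ distG I I n a b :=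
  le_csInf ⟨1, by simp, duplicatorWins_one I I n a b⟩ fun ε hε => h ε hε.1 hε.2

theorem duplicatorWins_of_distG_lt {n : ℕ} {a b : Δ} {ε : ℝ} (h : distG I I n a b < ε)
    (hε : ε ≤ 1) : DuplicatorWins I I n a b ε := by
  obtain ⟨ε', hε', hlt⟩ := exists_lt_of_csInf_lt
    (s := {ε | ε ∈ Set.Icc (0 : ℝ) 1 ∧ DuplicatorWins I I n a b ε})
    ⟨1, by simp, duplicatorWins_one I I n a b⟩ h
  exact hε'.2.mono I hlt.le hε

theorem distG_zero : distG I I 0 = fun _ _ => 0 := by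
  funext a b
  exact le_antisymm (distG_le I (by simp) trivial) (le_distG I fun ε hε _ => hε.1)

theorem distG_mem_Icc (n : ℕ) (a b : Δ) : distG I I n a b ∈ Set.Icc (0 : ℝ) 1 :=
  ⟨le_distG I fun _ hε _ => hε.1, distG_le I (by simp) (duplicatorWins_one I I n a b)⟩

theorem le_distG_succ [Finite NC] {n : ℕ} (hG : distG I I n = I.distK n) (a b : Δ) :
    I.distK (n + 1) a b ≤ distG I I (n + 1) a b := by
  have ha := I.r_eq_zero_or_isDist a
  have hb := I.r_eq_zero_or_isDist b
  refine le_distG I fun ε hε ⟨hA, h⟩ => ?_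
  rw [Model.distK]
  refine max_le (Real.iSup_le hA hε.1) ?_
  rcases h with ⟨h, h'⟩ | rfl | ⟨h, h', μ, e, hμ, he, hexp, hwin⟩
  · rw [I.blocking_iff.1 h, I.blocking_iff.1 h', kantorovich, extendZero_zero_zero]
    exact hε.1
  · exact kantorovich_le_one ha hb
  · have hd := I.isPseudometric_distK n
    refine (kantorovich_le_expectation hd (I.isDist_of_not_blocking h)
      (I.isDist_of_not_blocking h') hμ).trans (le_trans ?_ hexp)
    refine (hμ.isDist.summable_mul hd.mem_boundedFunctions).tsum_le_tsum (fun z => ?_)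
      (hμ.isDist.summable_mul (mem_boundedFunctions_of_mem_Icc he))
    -- Winning continuations bound the distance by `e` only where `μ` is positive; elsewhere both
    -- terms vanish.
    rcases (hμ.nonneg z).eq_or_lt with hz | hz
    · simp [← hz]
    · refine mul_le_mul_of_nonneg_left ?_ hz.le
      rw [← hG]
      exact distG_le I (he z) (hwin z.1 z.2 hz)

theorem distG_succ_le [Finite NC] {n : ℕ} (hG : distG I I n = I.distK n) (a b : Δ) :
    distG I I (n + 1) a b ≤ I.distK (n + 1) a b := by
  have hd := I.isPseudometric_distK n
  have hmem := (I.isPseudometric_distK (n + 1)).mem a b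
  refine le_of_forall_pos_le_add fun δ hδ => ?_
  rcases le_or_gt 1 (I.distK (n + 1) a b + δ) with h1 | h1
  · exact (distG_mem_Icc I (n + 1) a b).2.trans h1
  have hatom : ⨆ A, |I.atom A a - I.atom A b| ≤ I.distK (n + 1) a b := by
    rw [Model.distK]
    exact le_max_left _ _
  have hkant : kantorovich (I.distK n) (I.r a) (I.r b) ≤ I.distK (n + 1) a b := by
    rw [Model.distK]
    exact le_max_right _ _
  refine distG_le I ⟨by linarith [hmem.1], h1.le⟩
    ⟨fun A => (I.abs_atom_sub_le_iSup A a b).trans (by linarith), ?_⟩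
  by_cases ha : I.Blocking a <;> by_cases hb : I.Blocking b
  · exact .inl ⟨ha, hb⟩
  · rw [I.blocking_iff.1 ha, kantorovich,
      extendZero_zero_left _ (I.isDist_of_not_blocking hb).ne_zero] at hkant
    linarith
  · rw [I.blocking_iff.1 hb, kantorovich,
      extendZero_zero_right _ (I.isDist_of_not_blocking ha).ne_zero] at hkant
    linarith
  · obtain ⟨μ, hμ, hexp⟩ := exists_coupling_expectation_eq_kantorovich hd
      (I.isDist_of_not_blocking ha) (I.isDist_of_not_blocking hb)
    -- The infimum defining the game distance need not be attained a priori, so the deviations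
    -- exceed the distance by `δ`. Where the cap `1` applies, Duplicator wins anyway.
    have he : ∀ z : Δ × Δ, min 1 (I.distK n z.1 z.2 + δ) ∈ Set.Icc (0 : ℝ) 1 := fun z =>
      ⟨le_min zero_le_one (by linarith [(hd.mem z.1 z.2).1]), min_le_left _ _⟩
    refine .inr (.inr ⟨ha, hb, μ, _, hμ, he, ?_, fun a' b' _ => ?_⟩)
    · have hδb := const_mem_boundedFunctions (X := Δ × Δ) δ
      have h2 := hμ.isDist.expectation_mono (mem_boundedFunctions_of_mem_Icc he)
        ((boundedFunctions _).add_mem hd.mem_boundedFunctions hδb) fun z => min_le_right _ _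
      have h3 := hμ.isDist.expectation_add hd.mem_boundedFunctions hδb
      rw [hμ.isDist.expectation_const, hexp] at h3
      exact h2.trans (h3.trans_le (by linarith))
    · rcases le_or_gt 1 (I.distK n a' b' + δ) with h2 | h2
      · rw [min_eq_left h2]
        exact duplicatorWins_one I I n a' b'
      · rw [min_eq_right h2.le]
        exact duplicatorWins_of_distG_lt I (by rw [hG]; linarith) h2.le

theorem distG_eq_distK [Finite NC] (n : ℕ) : distG I I n = I.distK n := by
  induction n with
  | zero => rw [distG_zero, Model.distK_zero]
  | succ n ih =>
    funext a b
    exact le_antisymm (distG_succ_le I ih a b) (le_distG_succ I ih a b)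

end Game

end ProbALC

theorem mainTheorem2 {NC : Type*} [Finite NC] {Δ : Type*} (I : ProbALC.Model NC Δ) (n : ℕ) :
    ∃ d : Δ → Δ → ℝ,
      (ProbALC.distG I I n = d ∧ I.distW n = d ∧ I.distK n = d ∧ ProbALC.distL I I n = d) ∧
      ProbALC.IsPseudometric d ∧
      ProbALC.IsTotallyBounded d ∧
      ProbALC.IsDenseSubset (I.conceptFunctions n) (ProbALC.nonExp d) := by
  have htb := (I.hasFiniteCodes_distK n).isTotallyBounded
  have hKL := I.distK_eq_distL n
  refine ⟨I.distK n, ⟨ProbALC.distG_eq_distK I n, I.distW_eq_distK n, rfl, hKL.symm⟩,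
    I.isPseudometric_distK n, htb, ?_⟩
  rw [hKL] at htb ⊢
  exact I.isDenseSubset_conceptFunctions htb
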